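/- For functions $\omega,d:(0,\infty)\times\mathbb R^2\to\mathbb R$ consider the extended Navier–Stokes system $$\partial_t\omega+\nabla\cdot(u\,\omega)=\Delta\omega,\qquad \partial_t d=\Delta d,\qquad u=K_{BS}*\omega+\nabla^{-1}d,$$ where $K_{BS}(x)=\frac1{2\pi}\frac{x^\perp}{|x|^2}$, $x^\perp=(-x_2,x_1)$, and $\nabla^{-1}f=\frac1{2\pi}\frac{x}{|x|^2}*f$. Solutions are classical for $t>0$ ($C^2$ in $x$, differentiable in $t$), with the convolutions defining $u$ absolutely convergent. A solution is radially symmetric if, for each $t>0$, $\omega(\cdot,t)$ and $d(\cdot,t)$ depend only on $|x|$, and self-similar if $\lambda^2\omega(\lambda x,\lambda^2t)=\omega(x,t)$ and $\lambda^2d(\lambda x,\lambda^2t)=d(x,t)$ for all $\lambda,t>0$, $x\in\mathbb R^2$. Let $G(x)=\frac1{4\pi}e^{-|x|^2/4}$. (1) For every $\beta\in\mathbb R$ there is exactly one continuous radial function $W_s=W_s(\beta)$ on $\mathbb R^2$, differentiable and nonvanishing away from the origin, such that $$\frac{\partial_rW_s}{W_s}=-\frac r2+\frac{\beta}{2\pi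 r}\bigl(1-e^{-r^2/4}\bigr)\quad(r>0),\qquad \int_{\mathbb R^2}W_s\,dx=1.$$ (2) Put $\tilde\omega_\beta(x,t)=\frac1tW_s\bigl(\frac{x}{\sqrt t}\bigr)$ and $\tilde d_\beta(x,t)=\frac{\beta}{t}G\bigl(\frac{x}{\sqrt t}\bigr)$. For all $\alpha,\beta\in\mathbb R$, the pair $(\alpha\tilde\omega_\beta,\tilde d_\beta)$ is a radially symmetric self-similar solution of the system. (3) Conversely, every radially symmetric self-similar solution $(\omega,d)$ of the system is of this form: there are $\alpha,\beta\in\mathbb R$ with $(\omega,d)=(\alpha\tilde\omega_\beta,\tilde d_\beta)$ for all $t>0$. Moreover $\omega(\cdot,t)$ and $d(\cdot,t)$ are then integrable, and $\alpha=\int_{\mathbb R^2}\omega(x,t)\,dx$, $\beta=\int_{\mathbb R^2}d(x,t)\,dx$ for every $t>0$. -/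

import Mathlib

open MeasureTheory

noncomputable section

namespace ExtendedNS

/-- The Euclidean plane. -/
abbrev Plane : Type := EuclideanSpace ℝ (Fin 2)

/-- Rotation by a right angle, `x^⊥ = (-x₂, x₁)`. -/
def perp (x : Plane) : Plane := !₂[-(x 1), x 0]

/-- The Biot–Savart kernel `x^⊥ / (2π|x|²)`. -/
def kernelBS (x : Plane) : Plane := (2 * Real.pi * ‖x‖ ^ 2)⁻¹ • perp x

/-- The kernel `x / (2π|x|²)` of the operator `∇⁻¹`. -/
def kernelInvGrad (x : Plane) : Plane := (2 * Real.pi * ‖x‖ ^ 2)⁻¹ • x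

/-- `K_BS * f`. -/
def biotSavart (f : Plane → ℝ) : Plane → Plane :=
  convolution f kernelBS (ContinuousLinearMap.lsmul ℝ ℝ) volume

/-- `∇⁻¹ f = x / (2π|x|²) * f`. -/
def invGrad (f : Plane → ℝ) : Plane → Plane :=
  convolution f kernelInvGrad (ContinuousLinearMap.lsmul ℝ ℝ) volume

/-- The velocity field with vorticity `w` and divergence `q`. -/
def velocity (w q : Plane → ℝ) : Plane → Plane := fun x => biotSavart w x + invGrad q x

/-- The divergence of a vector field on the plane. -/
def divergence (v : Plane → Plane) (x : Plane) : ℝ :=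
  ∑ i : Fin 2, (fderiv ℝ v x (EuclideanSpace.single i 1)) i

/-- `(ω, d)` is a classical solution, for positive times, of
`∂ₜ ω + ∇ · (u ω) = Δ ω`, `∂ₜ d = Δ d`, `u = K_BS * ω + ∇⁻¹ d`.
The integrals defining `u` are required to converge absolutely; differentiability of `u` in space
(needed for `∇ · (u ω)`) follows from the other conditions and is recorded for convenience. -/
structure IsSolution (ω d : ℝ → Plane → ℝ) : Prop where
  contDiff_vorticity : ∀ t, 0 < t → ContDiff ℝ 2 (ω t)
  contDiff_div : ∀ t, 0 < t → ContDiff ℝ 2 (d t)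
  differentiableAt_vorticity : ∀ t, 0 < t → ∀ x, DifferentiableAt ℝ (fun s => ω s x) t
  differentiableAt_div : ∀ t, 0 < t → ∀ x, DifferentiableAt ℝ (fun s => d s x) t
  convolutionExists_vorticity : ∀ t, 0 < t →
    ConvolutionExists (ω t) kernelBS (ContinuousLinearMap.lsmul ℝ ℝ) volume
  convolutionExists_div : ∀ t, 0 < t →
    ConvolutionExists (d t) kernelInvGrad (ContinuousLinearMap.lsmul ℝ ℝ) volume
  differentiable_velocity : ∀ t, 0 < t → Differentiable ℝ (velocity (ω t) (d t))
  vorticity_eq : ∀ t, 0 < t → ∀ x,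
    deriv (fun s => ω s x) t + divergence (fun y => ω t y • velocity (ω t) (d t) y) x
      = Laplacian.laplacian (ω t) x
  div_eq : ∀ t, 0 < t → ∀ x, deriv (fun s => d s x) t = Laplacian.laplacian (d t) x

/-- A function on the plane is radial if it depends only on `|x|`. -/
def IsRadial (f : Plane → ℝ) : Prop := ∀ x y : Plane, ‖x‖ = ‖y‖ → f x = f y

/-- Invariance under the scaling `f(x,t) ↦ l² f(l x, l² t)`, `l > 0`, of the system. -/
def IsSelfSimilar (f : ℝ → Plane → ℝ) : Prop :=
  ∀ l : ℝ, 0 < l → ∀ t : ℝ, 0 < t → ∀ x : Plane, l ^ 2 * f (l ^ 2 * t) (l • x) = f t x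

/-- `(ω, d)` is a radially symmetric self-similar solution of the system. -/
structure IsRadialSelfSimilarSolution (ω d : ℝ → Plane → ℝ) : Prop where
  solution : IsSolution ω d
  radial_vorticity : ∀ t, 0 < t → IsRadial (ω t)
  radial_div : ∀ t, 0 < t → IsRadial (d t)
  selfSimilar_vorticity : IsSelfSimilar ω
  selfSimilar_div : IsSelfSimilar d

/-- The Gaussian `G(x) = exp(-|x|²/4) / (4π)`. -/
def gaussian (x : Plane) : ℝ := (4 * Real.pi)⁻¹ * Real.exp (-(‖x‖ ^ 2) / 4)

/-- The rescaling `t⁻¹ F(x/√t)`. -/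
def rescale (F : Plane → ℝ) (t : ℝ) (x : Plane) : ℝ := t⁻¹ * F ((Real.sqrt t)⁻¹ • x)

/-- The radial derivative `∂_r W`, away from the origin. -/
def radialDeriv (W : Plane → ℝ) (x : Plane) : ℝ := fderiv ℝ W x (‖x‖⁻¹ • x)

/-- `W` is a radial solution with total mass one of
`∂_r W / W = -r/2 + β/(2πr) (1 - exp(-r²/4))`, `r > 0`. -/
structure IsVortexProfile (β : ℝ) (W : Plane → ℝ) : Prop where
  continuous : Continuous W
  radial : IsRadial W
  differentiableAt : ∀ x, x ≠ 0 → DifferentiableAt ℝ W x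
  ne_zero : ∀ x, x ≠ 0 → W x ≠ 0
  ode : ∀ x, x ≠ 0 → radialDeriv W x / W x =
    -‖x‖ / 2 + β / (2 * Real.pi * ‖x‖) * (1 - Real.exp (-(‖x‖ ^ 2) / 4))
  integrable : Integrable W
  mass : ∫ x, W x = 1

end ExtendedNS

end

open MeasureTheory Set Filter Topology

namespace ExtendedNS

/-! Everything is expressed in ρ = |x|². For radial data ω = F(ρ), d = D(ρ), the field ∇⁻¹d is
radial and K_BS * ω is tangential, hence orthogonal to ∇ω and divergence free. With N(ρ) = ∫₀^ρ D
one has ∇⁻¹d = N(ρ)/(2ρ) · x off the origin, so that ∇·(uω) = F'N + FD = (FN)'. The vorticity thus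
drops out of its own transport term, and the system becomes triangular and linear: first d, then ω
with N known.

At time one, self-similarity turns ∂ₜω into -(ρF)', and Δω = 4(ρF')'. The vorticity equation is
therefore a total derivative, (4ρF' + (ρ - N)F)' = 0, and regularity at the origin makes the
constant vanish (`flux_eq_of_selfSimilar`). What remains is the first-order linear equation 4ρF' =
(N - ρ)F. For d the same argument with N = 0 gives D = b exp(-ρ/4); then N = 4b(1 - exp(-ρ/4)), and
F is a multiple of `vortexShape b (ρ / 4)` (`exists_eq_mul_vortexShape`). The same equation with b =
β/(4π) is the one defining the vortex profile, which gives its uniqueness.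

The velocity formula (`invGrad_radial`) uses only absolute convergence of the convolution: the
kernel is the conjugate of 1/(2πz), and the Cauchy transform of a radial function is computed circle
by circle. For existence the identities are read backwards, with `exists_vortexShape_le` supplying
Gaussian decay. -/

/-! ### Cauchy transform of radial functions -/

theorem integrableOn_comp_polarCoord_symm {E : Type*} [NormedAddCommGroup E] [NormedSpace ℝ E]
    {f : ℂ → E} (hf : Integrable f) :
    IntegrableOn (fun p : ℝ × ℝ => p.1 • f (Complex.polarCoord.symm p)) polarCoord.target := by
  have h1 : Integrable (f ∘ Complex.measurableEquivRealProd.symm) :=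
    (Complex.volume_preserving_equiv_real_prod.symm.integrable_comp_emb
      Complex.measurableEquivRealProd.symm.measurableEmbedding).2 hf
  have h2 := (integrableOn_image_iff_integrableOn_abs_det_fderiv_smul volume
    (measurableSet_Ioi.prod measurableSet_Ioo : MeasurableSet polarCoord.target)
    (fun p _ => (hasFDerivAt_polarCoord_symm p).hasFDerivWithinAt) polarCoord.symm.injOn
    (f ∘ Complex.measurableEquivRealProd.symm)).1 h1.integrableOn
  refine h2.congr_fun (fun p hp => ?_) polarCoord.open_target.measurableSet
  have hp1 : 0 < p.1 := hp.1
  simp only [det_fderivPolarCoordSymm, abs_of_pos hp1, Function.comp_apply,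
    Complex.measurableEquivRealProd_symm_polarCoord_symm_apply]

theorem setIntegral_Ioo_eq_circleAverage (g : ℂ → ℂ) :
    ∫ θ in Ioo (-Real.pi) Real.pi, g (Complex.exp (θ * Complex.I))
      = (2 * Real.pi) • Real.circleAverage g 0 1 := by
  have hper : Function.Periodic (fun θ : ℝ => g (Complex.exp (θ * Complex.I)))
      (2 * Real.pi) := by
    intro θ
    have : ((θ + 2 * Real.pi : ℝ) : ℂ) * Complex.I
      = θ * Complex.I + 2 * Real.pi * Complex.I := by push_cast; ring
    simp only [this, Complex.exp_periodic _]
  have h := hper.intervalIntegral_add_eq (-Real.pi) 0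
  rw [show -Real.pi + 2 * Real.pi = Real.pi by ring, zero_add] at h
  rw [← integral_Ioc_eq_integral_Ioo,
    ← intervalIntegral.integral_of_le (by linarith [Real.pi_pos]), h, Real.circleAverage,
    smul_smul, mul_inv_cancel₀ (by positivity), one_smul]
  simp [circleMap]

/-- Mean value property: the pole w/r lies outside the closed unit disc, and the value at the centre
is w⁻¹. -/
theorem setIntegral_inv_sub_circle_of_lt {w : ℂ} {r : ℝ} (hr : 0 < r) (h : r < ‖w‖) :
    ∫ θ in Ioo (-Real.pi) Real.pi, (w - r * Complex.exp (θ * Complex.I))⁻¹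
      = (2 * Real.pi) • w⁻¹ := by
  have hd : DiffContOnCl ℂ (fun z => (w - r * z)⁻¹) (Metric.ball 0 |1|) := by
    refine DifferentiableOn.diffContOnCl (fun z hz => ?_)
    rw [abs_one, closure_ball _ one_ne_zero, mem_closedBall_zero_iff] at hz
    refine (DifferentiableAt.inv (by fun_prop) ?_).differentiableWithinAt
    intro h0
    have : ‖w‖ = r * ‖z‖ := by
      rw [sub_eq_zero.1 h0, norm_mul, Complex.norm_real, Real.norm_of_nonneg hr.le]
    nlinarith
  rw [setIntegral_Ioo_eq_circleAverage (fun z => (w - r * z)⁻¹), hd.circleAverage]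
  simp

/-- Here the pole may lie inside the disc. Since conj z = z⁻¹ on the unit circle, the integrand
agrees there with the conjugate of z / (conj w · z - r), which is holomorphic on the disc and
vanishes at 0. -/
theorem setIntegral_inv_sub_circle_of_gt {w : ℂ} {r : ℝ} (h : ‖w‖ < r) :
    ∫ θ in Ioo (-Real.pi) Real.pi, (w - r * Complex.exp (θ * Complex.I))⁻¹ = 0 := by
  set g : ℂ → ℂ := fun z => z * ((starRingEnd ℂ w) * z - r)⁻¹ with hg
  have hd : DiffContOnCl ℂ g (Metric.ball 0 |1|) := by
    refine DifferentiableOn.diffContOnCl (fun z hz => ?_)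
    rw [abs_one, closure_ball _ one_ne_zero, mem_closedBall_zero_iff] at hz
    refine (differentiableAt_id.mul
      (DifferentiableAt.inv (by fun_prop) ?_)).differentiableWithinAt
    intro h0
    have : ‖w‖ * ‖z‖ = r := by
      have := congrArg norm (sub_eq_zero.1 h0)
      rwa [norm_mul, RCLike.norm_conj, Complex.norm_real,
        Real.norm_of_nonneg ((norm_nonneg _).trans h.le)] at this
    nlinarith [norm_nonneg w]
  have h1 : ∫ θ in Ioo (-Real.pi) Real.pi, g (Complex.exp (θ * Complex.I)) = 0 := by
    rw [setIntegral_Ioo_eq_circleAverage, hd.circleAverage]; simp [hg]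
  have h2 : ∀ θ : ℝ, (w - r * Complex.exp (θ * Complex.I))⁻¹
      = starRingEnd ℂ (g (Complex.exp (θ * Complex.I))) := by
    intro θ
    have he : starRingEnd ℂ (Complex.exp (θ * Complex.I))
      = (Complex.exp (θ * Complex.I))⁻¹ := by
      rw [← Complex.exp_conj, ← Complex.exp_neg]; simp
    have hne := Complex.exp_ne_zero (θ * Complex.I)
    simp only [hg, map_mul, map_inv₀, map_sub, Complex.conj_conj, Complex.conj_ofReal, he]
    rw [← mul_inv, mul_sub, mul_comm w, mul_inv_cancel_left₀ hne, mul_comm _ (r : ℂ)]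
  simp_rw [h2]
  rw [integral_conj, h1, map_zero]

/-- The Cauchy transform of a radial function. -/
theorem integral_radial_mul_inv_sub (F : ℝ → ℝ) (w : ℂ)
    (hF : Integrable (fun z : ℂ => F ‖z‖ • (w - z)⁻¹)) :
    ∫ z : ℂ, F ‖z‖ • (w - z)⁻¹ = (2 * Real.pi * ∫ r in (0 : ℝ)..‖w‖, r * F r) • w⁻¹ := by
  have h1 := integrableOn_comp_polarCoord_symm hF
  rw [← Complex.integral_comp_polarCoord_symm]
  have ht : polarCoord.target = Ioi (0 : ℝ) ×ˢ Ioo (-Real.pi) Real.pi := rfl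
  rw [ht] at h1 ⊢
  rw [Measure.volume_eq_prod] at h1 ⊢
  rw [setIntegral_prod _ h1]
  have hinner : ∀ᵐ r ∂(volume.restrict (Ioi (0 : ℝ))),
      ∫ θ in Ioo (-Real.pi) Real.pi, (r, θ).1 • F ‖Complex.polarCoord.symm (r, θ)‖ •
        (w - Complex.polarCoord.symm (r, θ))⁻¹
      = (Iio ‖w‖).indicator (fun r => (2 * Real.pi * (r * F r)) • w⁻¹) r := by
    -- The circle through w, where neither evaluation applies, is a null set of radii.
    have hae : ∀ᵐ r ∂(volume.restrict (Ioi (0 : ℝ))), r ≠ ‖w‖ :=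
      ae_restrict_of_ae (Measure.ae_ne volume _)
    filter_upwards [hae, ae_restrict_mem measurableSet_Ioi] with r hr hr0
    have hr0 : 0 < r := hr0
    have hpt : ∀ θ : ℝ, (r, θ).1 • F ‖Complex.polarCoord.symm (r, θ)‖ •
        (w - Complex.polarCoord.symm (r, θ))⁻¹
        = (r * F r) • (w - r * Complex.exp (θ * Complex.I))⁻¹ := by
      intro θ
      rw [Complex.norm_polarCoord_symm, Complex.polarCoord_symm_apply, Complex.exp_mul_I,
        smul_smul]
      simp only [abs_of_pos hr0, Complex.ofReal_cos, Complex.ofReal_sin]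
    simp_rw [hpt]
    rw [integral_smul]
    rcases lt_or_gt_of_ne hr with h | h
    · rw [setIntegral_inv_sub_circle_of_lt hr0 h, indicator_of_mem (show r ∈ Iio ‖w‖ from h),
        smul_smul]
      congr 1; ring
    · rw [setIntegral_inv_sub_circle_of_gt h, smul_zero, indicator_of_notMem]
      simpa using h.le
  rw [integral_congr_ae hinner, setIntegral_indicator measurableSet_Iio, Ioi_inter_Iio,
    integral_smul_const, integral_const_mul, ← integral_Ioc_eq_integral_Ioo,
    ← intervalIntegral.integral_of_le (norm_nonneg _)]

/-! ### Segment averages and their regularity -/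

/-- The average of `F` over the segment from `0` to `ρ`. -/
noncomputable def segmentAverage (F : ℝ → ℝ) (ρ : ℝ) : ℝ := ∫ s in (0 : ℝ)..1, F (ρ * s)

theorem mul_segmentAverage (F : ℝ → ℝ) (ρ : ℝ) :
    ρ * segmentAverage F ρ = ∫ s in (0 : ℝ)..ρ, F s := by
  simp [segmentAverage]

theorem hasDerivAt_mul_segmentAverage {F : ℝ → ℝ} (hF : Continuous F) (ρ : ℝ) :
    HasDerivAt (fun s => s * segmentAverage F s) (F ρ) ρ := by
  simp_rw [mul_segmentAverage]
  exact (hF.integral_hasStrictDerivAt 0 ρ).hasDerivAt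

/-- Continuity of F suffices away from 0. The classification relies on this, since the radial part
of a solution is shown to be differentiable only for ρ > 0. -/
theorem differentiableAt_segmentAverage_of_ne {F : ℝ → ℝ} (hF : Continuous F) {ρ : ℝ}
    (hρ : ρ ≠ 0) : DifferentiableAt ℝ (segmentAverage F) ρ := by
  have h : DifferentiableAt ℝ (fun s => s⁻¹ * (s * segmentAverage F s)) ρ :=
    (differentiableAt_inv hρ).mul (hasDerivAt_mul_segmentAverage hF ρ).differentiableAt
  refine h.congr_of_eventuallyEq ?_
  filter_upwards [isOpen_ne.mem_nhds hρ] with s hs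
  rw [inv_mul_cancel_left₀ hs]

theorem hasDerivAt_segmentAverage {F : ℝ → ℝ} (hF : ContDiff ℝ 1 F) (ρ : ℝ) :
    HasDerivAt (segmentAverage F) (∫ s in (0 : ℝ)..1, deriv F (ρ * s) * s) ρ := by
  have hc := hF.continuous
  have hc' : Continuous (deriv F) := hF.continuous_deriv le_rfl
  -- This interval contains every x * s with |x - ρ| < 1 and s in (0, 1], so C dominates the
  -- differentiated integrand.
  obtain ⟨C, hC⟩ := (isCompact_closedBall (0 : ℝ) (|ρ| + 1)).exists_bound_of_continuousOn
    hc'.continuousOn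
  refine (intervalIntegral.hasDerivAt_integral_of_dominated_loc_of_deriv_le (μ := volume)
    (F := fun x s => F (x * s)) (F' := fun x s => deriv F (x * s) * s) (bound := fun _ => C)
    (s := Metric.ball ρ 1)
    (Metric.ball_mem_nhds ρ one_pos)
    (Eventually.of_forall fun x => (by fun_prop : Continuous _).aestronglyMeasurable)
    ((by fun_prop : Continuous _).intervalIntegrable _ _)
    (by fun_prop : Continuous _).aestronglyMeasurable ?_ intervalIntegrable_const
    ?_).2
  · refine Eventually.of_forall fun s hs x hx => ?_
    rw [uIoc_of_le zero_le_one] at hs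
    have hx' : |x| ≤ |ρ| + 1 := by
      have h1 : |x - ρ| < 1 := by simpa [Real.dist_eq] using hx
      have h2 := abs_sub_abs_le_abs_sub x ρ
      linarith
    have hs' : |s| ≤ 1 := by rw [abs_of_pos hs.1]; exact hs.2
    have hb : ‖deriv F (x * s)‖ ≤ C := by
      apply hC
      rw [mem_closedBall_zero_iff, Real.norm_eq_abs, abs_mul]
      nlinarith [abs_nonneg x, abs_nonneg s]
    rw [norm_mul, Real.norm_eq_abs s]
    nlinarith [norm_nonneg (deriv F (x * s)), abs_nonneg s]
  · refine Eventually.of_forall fun s _ x _ => ?_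
    have h1 := (hF.differentiable one_ne_zero (x * s)).hasDerivAt
    exact h1.comp x (by simpa using (hasDerivAt_id x).mul_const s)

theorem contDiff_segmentAverage {F : ℝ → ℝ} (hF : ContDiff ℝ 1 F) :
    ContDiff ℝ 1 (segmentAverage F) := by
  have hc' : Continuous (deriv F) := hF.continuous_deriv le_rfl
  refine contDiff_one_iff_deriv.2
    ⟨fun ρ => (hasDerivAt_segmentAverage hF ρ).differentiableAt, ?_⟩
  rw [funext fun ρ => (hasDerivAt_segmentAverage hF ρ).deriv]
  exact intervalIntegral.continuous_parametric_intervalIntegral_of_continuous' (by fun_prop) 0 1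

theorem segmentAverage_add_mul_deriv {F : ℝ → ℝ} (hF : Continuous F) {ρ : ℝ}
    (h : DifferentiableAt ℝ (segmentAverage F) ρ) :
    segmentAverage F ρ + ρ * deriv (segmentAverage F) ρ = F ρ := by
  have h1 := (hasDerivAt_id ρ).mul h.hasDerivAt
  have h2 := h1.unique (hasDerivAt_mul_segmentAverage hF ρ)
  simpa using h2

/-! ### Velocity fields of radial data -/

/-- The identification of `ℂ` with the plane. -/
noncomputable def complexIsometry : ℂ ≃ₗᵢ[ℝ] Plane := Complex.orthonormalBasisOneI.repr

theorem kernelInvGrad_complexIsometry (z : ℂ) :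
    kernelInvGrad (complexIsometry z)
      = complexIsometry ((2 * Real.pi)⁻¹ • (starRingEnd ℂ) z⁻¹) := by
  have : (starRingEnd ℂ) z⁻¹ = (‖z‖ ^ 2)⁻¹ • z := by
    rw [Complex.inv_def, map_mul, Complex.conj_conj, Complex.conj_ofReal,
      Complex.normSq_eq_norm_sq, mul_comm, Complex.real_smul]
  rw [kernelInvGrad, LinearIsometryEquiv.norm_map, this, ← map_smul, smul_smul, mul_inv]

/-- Rotation by a right angle as a linear isometry. -/
noncomputable def perpIsometry : Plane ≃ₗᵢ[ℝ] Plane where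
  toFun := perp
  invFun x := -perp x
  map_add' x y := by ext i; fin_cases i <;> simp [perp]; ring
  map_smul' c x := by ext i; fin_cases i <;> simp [perp]
  left_inv x := by ext i; fin_cases i <;> simp [perp]
  right_inv x := by ext i; fin_cases i <;> simp [perp]
  norm_map' x := by
    simp [EuclideanSpace.norm_eq, perp, add_comm]

@[simp] theorem perpIsometry_apply (x : Plane) : perpIsometry x = perp x := rfl

/-- Rotation is a linear isometry, so it commutes with the convolution integral and preserves
integrability; only ∇⁻¹ needs to be analysed. -/
theorem kernelBS_eq (x : Plane) : kernelBS x = perpIsometry (kernelInvGrad x) := by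
  rw [kernelInvGrad, map_smul, kernelBS, perpIsometry_apply]

theorem convolutionExistsAt_kernelBS_iff {f : Plane → ℝ} {x : Plane} :
    ConvolutionExistsAt f kernelBS x (ContinuousLinearMap.lsmul ℝ ℝ) volume ↔
      ConvolutionExistsAt f kernelInvGrad x (ContinuousLinearMap.lsmul ℝ ℝ) volume := by
  simp only [ConvolutionExistsAt, ContinuousLinearMap.lsmul_apply, kernelBS_eq, ← map_smul]
  exact perpIsometry.toContinuousLinearEquiv.integrable_comp_iff

theorem biotSavart_eq_perp_invGrad (f : Plane → ℝ) (x : Plane) :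
    biotSavart f x = perp (invGrad f x) := by
  simp only [biotSavart, invGrad, convolution, ContinuousLinearMap.lsmul_apply, kernelBS_eq,
    ← map_smul]
  exact perpIsometry.toContinuousLinearEquiv.integral_comp_comm _

theorem integral_mul_comp_sq {F : ℝ → ℝ} (hF : Continuous F) (R : ℝ) :
    ∫ r in (0 : ℝ)..R, r * F (r ^ 2) = R ^ 2 * segmentAverage F (R ^ 2) / 2 := by
  have h := intervalIntegral.integral_comp_mul_deriv (a := 0) (b := R) (f := fun r => r ^ 2)
    (f' := fun r => 2 * r) (g := F) (fun x _ => by simpa using hasDerivAt_pow 2 x)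
    (by fun_prop) hF
  rw [mul_segmentAverage]
  norm_num at h
  rw [← h, eq_div_iff two_ne_zero, mul_comm, ← intervalIntegral.integral_const_mul]
  congr 1; ext r; ring

/-- The velocity generated by a radial divergence points outward. -/
theorem invGrad_radial {F : ℝ → ℝ} (hF : Continuous F) {x : Plane}
    (h : ConvolutionExistsAt (fun y => F (‖y‖ ^ 2)) kernelInvGrad x
      (ContinuousLinearMap.lsmul ℝ ℝ) volume) :
    invGrad (fun y => F (‖y‖ ^ 2)) x = (segmentAverage F (‖x‖ ^ 2) / 2) • x := by
  obtain ⟨w, rfl⟩ := complexIsometry.surjective x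
  have hpt : ∀ z : ℂ, F (‖complexIsometry z‖ ^ 2) • kernelInvGrad (complexIsometry w -
      complexIsometry z) = complexIsometry ((2 * Real.pi)⁻¹ •
        Complex.conjLIE ((fun r => F (r ^ 2)) ‖z‖ • (w - z)⁻¹)) := by
    intro z
    rw [← map_sub, kernelInvGrad_complexIsometry, LinearIsometryEquiv.norm_map, ← map_smul]
    congr 1
    rw [map_smul, smul_comm]
    rfl
  have hmp := complexIsometry.measurePreserving
  have hme := complexIsometry.toHomeomorph.measurableEmbedding
  simp only [ConvolutionExistsAt, ContinuousLinearMap.lsmul_apply] at h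
  rw [← hmp.integrable_comp_emb hme] at h
  simp only [Function.comp_def, hpt] at h
  have h2 : Integrable (fun z : ℂ => (fun r => F (r ^ 2)) ‖z‖ • (w - z)⁻¹) := by
    have h3 := complexIsometry.toContinuousLinearEquiv.integrable_comp_iff.1 h
    have h3' := (integrable_smul_iff (c := (2 * Real.pi)⁻¹) (by positivity)
      (fun z : ℂ => Complex.conjLIE ((fun r => F (r ^ 2)) ‖z‖ • (w - z)⁻¹))).1 h3
    exact Complex.conjLIE.toContinuousLinearEquiv.integrable_comp_iff.1 h3'
  simp only [invGrad, convolution, ContinuousLinearMap.lsmul_apply]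
  rw [← hmp.integral_comp hme]
  simp only [hpt]
  have h4 := complexIsometry.toContinuousLinearEquiv.integral_comp_comm (μ := volume)
    (fun z : ℂ => (2 * Real.pi)⁻¹ • Complex.conjLIE ((fun r => F (r ^ 2)) ‖z‖ • (w - z)⁻¹))
  refine h4.trans ?_
  rw [integral_smul]
  have h5 := Complex.conjLIE.toContinuousLinearEquiv.integral_comp_comm (μ := volume)
    (fun z : ℂ => (fun r => F (r ^ 2)) ‖z‖ • (w - z)⁻¹)
  have h6 := integral_radial_mul_inv_sub (fun r => F (r ^ 2)) w h2
  rw [integral_mul_comp_sq hF] at h6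
  rw [h6] at h5
  have h7 : (2 * Real.pi)⁻¹ • Complex.conjLIE.toContinuousLinearEquiv
      ((2 * Real.pi * (‖w‖ ^ 2 * segmentAverage F (‖w‖ ^ 2) / 2)) • w⁻¹)
      = (segmentAverage F (‖w‖ ^ 2) / 2) • w := by
    rw [map_smul, smul_smul]
    have : Complex.conjLIE.toContinuousLinearEquiv w⁻¹ = (‖w‖ ^ 2)⁻¹ • w := by
      change (starRingEnd ℂ) w⁻¹ = _
      rw [Complex.inv_def, map_mul, Complex.conj_conj, Complex.conj_ofReal,
        Complex.normSq_eq_norm_sq, mul_comm, Complex.real_smul]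
    rw [this, smul_smul]
    by_cases hw : w = 0
    · simp [hw]
    · have : ‖w‖ ≠ 0 := norm_ne_zero_iff.2 hw
      congr 1
      field_simp
  rw [LinearIsometryEquiv.norm_map, ← map_smul, ← h7]
  exact congrArg complexIsometry (congrArg _ h5)

/-- The velocity field with radial vorticity and divergence. -/
theorem velocity_radial {F D : ℝ → ℝ} (hF : Continuous F) (hD : Continuous D) {x : Plane}
    (h : ConvolutionExistsAt (fun y => F (‖y‖ ^ 2)) kernelBS x
      (ContinuousLinearMap.lsmul ℝ ℝ) volume)
    (h' : ConvolutionExistsAt (fun y => D (‖y‖ ^ 2)) kernelInvGrad x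
      (ContinuousLinearMap.lsmul ℝ ℝ) volume) :
    velocity (fun y => F (‖y‖ ^ 2)) (fun y => D (‖y‖ ^ 2)) x
      = (segmentAverage D (‖x‖ ^ 2) / 2) • x + (segmentAverage F (‖x‖ ^ 2) / 2) • perp x := by
  rw [velocity, biotSavart_eq_perp_invGrad, invGrad_radial hD h',
    invGrad_radial hF (convolutionExistsAt_kernelBS_iff.1 h), add_comm]
  congr 1
  exact map_smul perpIsometry _ _

/-! ### Absolute convergence of the convolutions -/

theorem measurable_kernelInvGrad : Measurable kernelInvGrad := by
  unfold kernelInvGrad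
  fun_prop

theorem norm_kernelInvGrad_le (x : Plane) : ‖kernelInvGrad x‖ ≤ ‖x‖⁻¹ := by
  rw [kernelInvGrad, norm_smul, norm_inv, Real.norm_of_nonneg (by positivity), mul_inv]
  by_cases hx : x = 0
  · simp [hx]
  have : 0 < ‖x‖ := norm_pos_iff.2 hx
  have h1 : (2 * Real.pi)⁻¹ ≤ 1 := inv_le_one_of_one_le₀ (by linarith [Real.pi_gt_three])
  have h2 : (‖x‖ ^ 2)⁻¹ * ‖x‖ = ‖x‖⁻¹ := by field_simp
  rw [mul_assoc, h2]
  exact mul_le_of_le_one_left (by positivity) h1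

/-- The singularity has order 1, below the dimension 2. -/
theorem locallyIntegrable_kernelInvGrad : LocallyIntegrable kernelInvGrad := by
  refine locallyIntegrable_of_norm_le_rpow (C := 1) (α := 1) (by simp) (by simp)
    (Eventually.of_forall fun x => ?_) measurable_kernelInvGrad.aestronglyMeasurable
  rw [one_mul, Real.rpow_neg_one]
  exact norm_kernelInvGrad_le x

/-- The convolution with the kernel of `∇⁻¹` converges for bounded integrable functions. -/
theorem convolutionExists_kernelInvGrad {f : Plane → ℝ} (hf : Continuous f) {C : ℝ}
    (hC : ∀ x, |f x| ≤ C) (hi : Integrable f) :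
    ConvolutionExists f kernelInvGrad (ContinuousLinearMap.lsmul ℝ ℝ) volume := by
  intro x
  -- Near the singularity f is bounded and the kernel integrable; at distance more than 1 the kernel
  -- is at most 1 and f is integrable.
  have hK : Integrable ((Metric.closedBall (0 : Plane) 1).indicator kernelInvGrad) := by
    rw [integrable_indicator_iff Metric.isClosed_closedBall.measurableSet]
    exact locallyIntegrable_kernelInvGrad.integrableOn_isCompact (isCompact_closedBall _ _)
  have hK' : Integrable (fun y => C * ‖(Metric.closedBall (0 : Plane) 1).indicator kernelInvGrad
      (x - y)‖ + ‖f y‖) := ((hK.comp_sub_left x).norm.const_mul C).add hi.norm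
  refine hK'.mono' ?_ (Eventually.of_forall fun y => ?_)
  · simp only [ContinuousLinearMap.lsmul_apply]
    exact (hf.measurable.smul
      (measurable_kernelInvGrad.comp (measurable_const.sub measurable_id))).aestronglyMeasurable
  · rw [ContinuousLinearMap.lsmul_apply, norm_smul]
    have hC0 : 0 ≤ C := (abs_nonneg _).trans (hC 0)
    by_cases hy : x - y ∈ Metric.closedBall (0 : Plane) 1
    · rw [indicator_of_mem hy]
      have := mul_le_mul_of_nonneg_right (hC y) (norm_nonneg (kernelInvGrad (x - y)))
      rw [Real.norm_eq_abs]
      linarith [abs_nonneg (f y)]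
    · rw [indicator_of_notMem hy, norm_zero, mul_zero, zero_add]
      refine mul_le_of_le_one_right (norm_nonneg _) ((norm_kernelInvGrad_le _).trans ?_)
      rw [mem_closedBall_zero_iff, not_le] at hy
      exact inv_le_one_of_one_le₀ hy.le

/-! ### Divergence and Laplacian in the variable |x|² -/

theorem hasFDerivAt_comp_norm_sq {F : ℝ → ℝ} {F' : ℝ} {x : Plane}
    (h : HasDerivAt F F' (‖x‖ ^ 2)) :
    HasFDerivAt (fun y : Plane => F (‖y‖ ^ 2)) ((2 * F') • innerSL ℝ x) x := by
  have h1 := h.comp_hasFDerivAt x (hasStrictFDerivAt_norm_sq x).hasFDerivAt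
  convert! h1 using 1
  ext y
  simp
  ring

/-- The divergence of a rotationally equivariant vector field. -/
theorem divergence_radial_add_perp {P Q : ℝ → ℝ} {P' Q' : ℝ} {x : Plane}
    (hP : HasDerivAt P P' (‖x‖ ^ 2)) (hQ : HasDerivAt Q Q' (‖x‖ ^ 2)) :
    divergence (fun y => P (‖y‖ ^ 2) • y + Q (‖y‖ ^ 2) • perp y) x
      = 2 * P (‖x‖ ^ 2) + 2 * ‖x‖ ^ 2 * P' := by
  have h1 := (hasFDerivAt_comp_norm_sq hP).smul (hasFDerivAt_id x)
  have h2 := (hasFDerivAt_comp_norm_sq hQ).smul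
    (perpIsometry.toContinuousLinearEquiv.hasFDerivAt (x := x))
  have h3 := h1.add h2
  have h4 : fderiv ℝ (fun y => P (‖y‖ ^ 2) • y + Q (‖y‖ ^ 2) • perp y) x = _ := h3.fderiv
  rw [divergence, h4]
  have hn : ‖x‖ ^ 2 = x 0 ^ 2 + x 1 ^ 2 := by
    simp [EuclideanSpace.norm_sq_eq, Fin.sum_univ_two]
  have hpe : ∀ y, perpIsometry.toContinuousLinearEquiv y = perp y := fun _ => rfl
  -- The Q terms cancel: `perp` is divergence free and the gradient of Q(|y|²) is parallel to y.
  simp [Fin.sum_univ_two, hpe, perp, hn, EuclideanSpace.inner_single_right]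
  ring

/-- The Laplacian of a radial function in terms of `‖x‖ ^ 2`. -/
theorem laplacian_comp_norm_sq {F F' : ℝ → ℝ} {F'' : ℝ} {x : Plane}
    (h : ∀ᶠ s in 𝓝 (‖x‖ ^ 2), HasDerivAt F (F' s) s) (h' : HasDerivAt F' F'' (‖x‖ ^ 2)) :
    Laplacian.laplacian (fun y : Plane => F (‖y‖ ^ 2)) x
      = 4 * ‖x‖ ^ 2 * F'' + 4 * F' (‖x‖ ^ 2) := by
  have hc : ContinuousAt (fun y : Plane => ‖y‖ ^ 2) x := by fun_prop
  have h1 : fderiv ℝ (fun y : Plane => F (‖y‖ ^ 2)) =ᶠ[𝓝 x]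
      fun y => (2 * F' (‖y‖ ^ 2)) • innerSL ℝ y := by
    filter_upwards [hc.eventually h] with y hy
    exact (hasFDerivAt_comp_norm_sq hy).fderiv
  have h2 := ((hasFDerivAt_comp_norm_sq h').const_mul 2).smul
    ((innerSL ℝ : Plane →L[ℝ] _).hasFDerivAt (x := x))
  have h3 : fderiv ℝ (fderiv ℝ (fun y : Plane => F (‖y‖ ^ 2))) x = _ :=
    (h1.fderiv_eq).trans h2.fderiv
  rw [congrFun (InnerProductSpace.laplacian_eq_iteratedFDeriv_orthonormalBasis _
    (EuclideanSpace.basisFun (Fin 2) ℝ)) x]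
  simp only [iteratedFDeriv_two_apply, h3]
  have hn : ‖x‖ ^ 2 = x 0 ^ 2 + x 1 ^ 2 := by
    simp [EuclideanSpace.norm_sq_eq, Fin.sum_univ_two]
  have hin : ∀ a b : Plane, innerSL ℝ a b = inner ℝ a b := fun _ _ => rfl
  simp [Fin.sum_univ_two, hn, hin, EuclideanSpace.inner_single_right]
  ring

/-- The divergence of the flux of a radial vorticity. -/
theorem divergence_smul_velocity_radial {F D : ℝ → ℝ} (hF : Continuous F) (hD : Continuous D)
    (hFc : ConvolutionExists (fun y => F (‖y‖ ^ 2)) kernelBS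
      (ContinuousLinearMap.lsmul ℝ ℝ) volume)
    (hDc : ConvolutionExists (fun y => D (‖y‖ ^ 2)) kernelInvGrad
      (ContinuousLinearMap.lsmul ℝ ℝ) volume)
    {x : Plane} {F' : ℝ} (hF' : HasDerivAt F F' (‖x‖ ^ 2))
    (hFa : DifferentiableAt ℝ (segmentAverage F) (‖x‖ ^ 2))
    (hDa : DifferentiableAt ℝ (segmentAverage D) (‖x‖ ^ 2)) :
    divergence (fun y => F (‖y‖ ^ 2) •
        velocity (fun y => F (‖y‖ ^ 2)) (fun y => D (‖y‖ ^ 2)) y) x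
      = F' * (∫ s in (0 : ℝ)..‖x‖ ^ 2, D s) + F (‖x‖ ^ 2) * D (‖x‖ ^ 2) := by
  have h1 : (fun y => F (‖y‖ ^ 2) •
        velocity (fun y => F (‖y‖ ^ 2)) (fun y => D (‖y‖ ^ 2)) y)
      = fun y => (fun s => F s * (segmentAverage D s / 2)) (‖y‖ ^ 2) • y
        + (fun s => F s * (segmentAverage F s / 2)) (‖y‖ ^ 2) • perp y := by
    ext1 y
    rw [velocity_radial hF hD (hFc y) (hDc y), smul_add, smul_smul, smul_smul]
  rw [h1]
  refine (divergence_radial_add_perp (hF'.mul (hDa.hasDerivAt.div_const 2))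
    (hF'.mul (hFa.hasDerivAt.div_const 2))).trans ?_
  rw [← mul_segmentAverage, ← segmentAverage_add_mul_deriv hD hDa, Pi.mul_apply]
  ring

/-! ### The vortex shape and its decay -/

/-- The entire function `(1 - exp (-v)) / v`. -/
noncomputable def expQuotient : ℝ → ℝ := segmentAverage fun s => Real.exp (-s)

theorem mul_expQuotient (v : ℝ) : v * expQuotient v = 1 - Real.exp (-v) := by
  rw [expQuotient, mul_segmentAverage]
  simp

theorem contDiff_expQuotient : ContDiff ℝ 1 expQuotient :=
  contDiff_segmentAverage (by fun_prop)

/-- The primitive of `(1 - exp (-v)) / v`. -/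
noncomputable def expQuotientPrimitive (v : ℝ) : ℝ := ∫ s in (0 : ℝ)..v, expQuotient s

theorem hasDerivAt_expQuotientPrimitive (v : ℝ) :
    HasDerivAt expQuotientPrimitive (expQuotient v) v :=
  (contDiff_expQuotient.continuous.integral_hasStrictDerivAt 0 v).hasDerivAt

theorem contDiff_expQuotientPrimitive : ContDiff ℝ 2 expQuotientPrimitive := by
  rw [show (2 : WithTop ℕ∞) = 1 + 1 by norm_num, contDiff_succ_iff_deriv]
  refine ⟨fun v => (hasDerivAt_expQuotientPrimitive v).differentiableAt, by simp, ?_⟩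
  rw [funext fun v => (hasDerivAt_expQuotientPrimitive v).deriv]
  exact contDiff_expQuotient

/-- The unnormalized vortex profile as a function of `v = r² / 4`. -/
noncomputable def vortexShape (b v : ℝ) : ℝ := Real.exp (-v + b * expQuotientPrimitive v)

theorem vortexShape_pos (b v : ℝ) : 0 < vortexShape b v := Real.exp_pos _

theorem vortexShape_zero_left (v : ℝ) : vortexShape 0 v = Real.exp (-v) := by
  simp [vortexShape]

theorem contDiff_vortexShape (b : ℝ) : ContDiff ℝ 2 (vortexShape b) := by
  have := contDiff_expQuotientPrimitive
  unfold vortexShape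
  fun_prop

/-- The derivative of the vortex profile. -/
noncomputable def vortexShapeDeriv (b v : ℝ) : ℝ := vortexShape b v * (-1 + b * expQuotient v)

theorem hasDerivAt_vortexShape (b v : ℝ) :
    HasDerivAt (vortexShape b) (vortexShapeDeriv b v) v :=
  ((hasDerivAt_id v).neg.add ((hasDerivAt_expQuotientPrimitive v).const_mul b)).exp

theorem mul_vortexShapeDeriv (b v : ℝ) :
    v * vortexShapeDeriv b v = vortexShape b v * (-v + b * (1 - Real.exp (-v))) := by
  rw [vortexShapeDeriv, ← mul_expQuotient]; ring

theorem differentiable_vortexShapeDeriv (b : ℝ) : Differentiable ℝ (vortexShapeDeriv b) := by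
  have h1 := (contDiff_vortexShape b).differentiable two_ne_zero
  have h2 := contDiff_expQuotient.differentiable one_ne_zero
  unfold vortexShapeDeriv
  fun_prop

/-- The equation satisfied by the profile, differentiated once. -/
theorem vortexShapeDeriv_add_mul_deriv (b v : ℝ) :
    vortexShapeDeriv b v + v * deriv (vortexShapeDeriv b) v
      = vortexShapeDeriv b v * (-v + b * (1 - Real.exp (-v)))
        + vortexShape b v * (-1 + b * Real.exp (-v)) := by
  have h1 := (hasDerivAt_id v).mul (differentiable_vortexShapeDeriv b v).hasDerivAt
  have h2 : HasDerivAt (fun s : ℝ => -s + b * (1 - Real.exp (-s)))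
      (-1 + b * Real.exp (-v)) v := by
    have h3 := (hasDerivAt_id v).neg.add (((hasDerivAt_id v).neg.exp.const_sub 1).const_mul b)
    convert! h3 using 1
    simp
  have h4 := (hasDerivAt_vortexShape b v).mul h2
  have h5 : (id * vortexShapeDeriv b : ℝ → ℝ)
      = vortexShape b * fun s : ℝ => -s + b * (1 - Real.exp (-s)) := by
    ext s
    exact mul_vortexShapeDeriv b s
  rw [h5] at h1
  simpa using h1.unique h4

/-- The term b ∫₀^v (1 - exp(-s))/s ds grows only logarithmically, so half of the decay exp(-v)
absorbs it. -/
theorem exists_vortexShape_le (b : ℝ) :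
    ∃ C, ∀ v, 0 ≤ v → vortexShape b v ≤ C * Real.exp (-v / 2) := by
  set g : ℝ → ℝ := fun v => -v / 2 + b * expQuotientPrimitive v with hg
  have hgd : ∀ v, HasDerivAt g (-1 / 2 + b * expQuotient v) v := fun v =>
    ((hasDerivAt_id v).neg.div_const 2).add ((hasDerivAt_expQuotientPrimitive v).const_mul b)
  have hgc : Continuous g := continuous_iff_continuousAt.2 fun v => (hgd v).continuousAt
  -- For v > 0 one has v g'(v) ≤ -v/2 + |b|, which is negative beyond 2|b|; hence g decreases on [V,
  -- ∞), and compactness bounds it on [0, V].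
  set V : ℝ := 2 * |b| + 1 with hV
  have hV0 : 0 < V := by positivity
  obtain ⟨C, hC⟩ := (isCompact_Icc (a := (0 : ℝ)) (b := V)).exists_bound_of_continuousOn
    hgc.continuousOn
  have hanti : AntitoneOn g (Ici V) := by
    refine antitoneOn_of_deriv_nonpos (convex_Ici V) hgc.continuousOn
      (fun v _ => (hgd v).differentiableAt.differentiableWithinAt) fun v hv => ?_
    rw [interior_Ici] at hv
    have hv : V < v := hv
    have hv0 : 0 < v := hV0.trans hv
    rw [(hgd v).deriv]
    have h1 := mul_expQuotient v
    have h2 : 0 < Real.exp (-v) := Real.exp_pos _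
    have h3 : Real.exp (-v) ≤ 1 := Real.exp_le_one_iff.2 (by linarith)
    have h4 : b * (1 - Real.exp (-v)) ≤ |b| := by
      have := mul_le_mul_of_nonneg_right (le_abs_self b) (sub_nonneg.2 h3)
      nlinarith [abs_nonneg b]
    have h5 : v * (-1 / 2 + b * expQuotient v) ≤ 0 := by
      have : v * (-1 / 2 + b * expQuotient v) = -v / 2 + b * (v * expQuotient v) := by ring
      rw [this, h1]; linarith
    exact nonpos_of_mul_nonpos_right h5 hv0
  have hgC : ∀ v, 0 ≤ v → g v ≤ C := by
    intro v hv
    rcases le_total v V with h | h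
    · exact (le_abs_self _).trans (hC v ⟨hv, h⟩)
    · exact (hanti self_mem_Ici h h).trans
        ((le_abs_self _).trans (hC V ⟨hV0.le, le_rfl⟩))
  refine ⟨Real.exp C, fun v hv => ?_⟩
  rw [← Real.exp_add, vortexShape, Real.exp_le_exp]
  have := hgC v hv
  simp only [hg] at this
  linarith

theorem integral_exp_neg_mul_norm_sq {a : ℝ} (ha : 0 < a) :
    ∫ x : Plane, Real.exp (-a * ‖x‖ ^ 2) = Real.pi / a := by
  have := GaussianFourier.integral_rexp_neg_mul_sq_norm (V := Plane) ha
  simpa using this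

theorem integrable_exp_neg_mul_norm_sq {a : ℝ} (ha : 0 < a) :
    Integrable (fun x : Plane => Real.exp (-a * ‖x‖ ^ 2)) := by
  refine Integrable.of_integral_ne_zero ?_
  rw [integral_exp_neg_mul_norm_sq ha]
  positivity

theorem integrable_vortexShape (b : ℝ) {a : ℝ} (ha : 0 < a) :
    Integrable (fun x : Plane => vortexShape b (‖x‖ ^ 2 / a)) := by
  obtain ⟨C, hC⟩ := exists_vortexShape_le b
  have hc := (contDiff_vortexShape b).continuous
  refine ((integrable_exp_neg_mul_norm_sq (a := 1 / (2 * a)) (by positivity)).const_mul C).mono'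
    (by fun_prop : Continuous _).aestronglyMeasurable (Eventually.of_forall fun x => ?_)
  rw [Real.norm_of_nonneg (vortexShape_pos _ _).le]
  refine (hC _ (by positivity)).trans (le_of_eq ?_)
  congr 2
  field_simp

theorem exists_abs_vortexShape_le (b : ℝ) :
    ∃ C, ∀ v, 0 ≤ v → |vortexShape b v| ≤ C := by
  obtain ⟨C, hC⟩ := exists_vortexShape_le b
  have hC0 : 0 ≤ C := by
    have := (vortexShape_pos b 0).le.trans (hC 0 le_rfl)
    simpa using this
  refine ⟨C, fun v hv => ?_⟩
  rw [abs_of_pos (vortexShape_pos _ _)]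
  exact (hC v hv).trans (mul_le_of_le_one_right hC0 (Real.exp_le_one_iff.2 (by linarith)))

/-! ### First-order equation and first integral -/

/-- A function with vanishing derivative on the half-line is constant there. -/
theorem eq_of_hasDerivAt_zero_Ioi {Φ : ℝ → ℝ} (h : ∀ ρ, 0 < ρ → HasDerivAt Φ 0 ρ) {s ρ : ℝ}
    (hs : 0 < s) (hρ : 0 < ρ) : Φ s = Φ ρ :=
  isOpen_Ioi.is_const_of_deriv_eq_zero isPreconnected_Ioi
    (fun x hx => (h x hx).differentiableAt.differentiableWithinAt)
    (fun x hx => (h x hx).deriv) hs hρ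

/-- The only solutions of the first-order profile equation are multiples of `vortexShape`. -/
theorem exists_eq_mul_vortexShape {F F' : ℝ → ℝ} {b : ℝ} (hF : Continuous F)
    (hF' : ∀ ρ, 0 < ρ → HasDerivAt F (F' ρ) ρ)
    (h : ∀ ρ, 0 < ρ → 4 * ρ * F' ρ = (4 * b * (1 - Real.exp (-(ρ / 4))) - ρ) * F ρ) :
    ∃ c, ∀ ρ, 0 ≤ ρ → F ρ = c * vortexShape b (ρ / 4) := by
  have hH : ∀ ρ, HasDerivAt (fun ρ => vortexShape b (ρ / 4)) (vortexShapeDeriv b (ρ / 4) / 4) ρ :=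
    fun ρ => by
      have := (hasDerivAt_vortexShape b (ρ / 4)).comp ρ ((hasDerivAt_id ρ).div_const 4)
      simpa [div_eq_mul_inv] using! this
  have hq : ∀ ρ, 0 < ρ → HasDerivAt (fun ρ => F ρ / vortexShape b (ρ / 4)) 0 ρ := by
    intro ρ hρ
    have hne := (vortexShape_pos b (ρ / 4)).ne'
    convert! (hF' ρ hρ).div (hH ρ) hne using 1
    symm
    rw [div_eq_zero_iff]
    left
    have h1 := h ρ hρ
    have h2 := mul_vortexShapeDeriv b (ρ / 4)
    -- The numerator of the quotient rule, multiplied by 4ρ so that both first-order equations can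
    -- be substituted.
    have h3 : 4 * ρ * (F' ρ * vortexShape b (ρ / 4) - F ρ * (vortexShapeDeriv b (ρ / 4) / 4))
        = 0 := by
      linear_combination vortexShape b (ρ / 4) * h1 - 4 * F ρ * h2
    exact (mul_eq_zero.1 h3).resolve_left (by positivity)
  have hpos : ∀ ρ, 0 < ρ → F ρ = F 1 / vortexShape b (1 / 4) * vortexShape b (ρ / 4) := by
    intro ρ hρ
    rw [← div_eq_iff (vortexShape_pos b (ρ / 4)).ne']
    exact eq_of_hasDerivAt_zero_Ioi hq hρ one_pos
  refine ⟨F 1 / vortexShape b (1 / 4), fun ρ hρ => ?_⟩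
  -- The equation degenerates at ρ = 0, so the value there comes from continuity.
  have hcl : EqOn F (fun ρ => F 1 / vortexShape b (1 / 4) * vortexShape b (ρ / 4))
      (closure (Ioi 0)) := by
    have hc := (contDiff_vortexShape b).continuous
    exact EqOn.closure (fun ρ hρ => hpos ρ hρ) hF (by fun_prop)
  rw [closure_Ioi] at hcl
  exact hcl hρ

/-- The first integral of the radial self-similar equation with outward flux `N`. -/
theorem flux_eq_of_selfSimilar {F F' F'' N D : ℝ → ℝ} (hF : Continuous F)
    (hF' : ∀ ρ, 0 < ρ → HasDerivAt F (F' ρ) ρ)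
    (hF'' : ∀ ρ, 0 < ρ → HasDerivAt F' (F'' ρ) ρ)
    (hN : ∀ ρ, HasDerivAt N (D ρ) ρ) (hN0 : N 0 = 0)
    (hlim : Tendsto (fun ρ => ρ * F' ρ) (𝓝[>] 0) (𝓝 0))
    (h : ∀ ρ, 0 < ρ → -(F ρ + ρ * F' ρ) + (F' ρ * N ρ + F ρ * D ρ)
      = 4 * ρ * F'' ρ + 4 * F' ρ) :
    ∀ ρ, 0 < ρ → 4 * ρ * F' ρ = (N ρ - ρ) * F ρ := by
  -- The hypothesis `h` says exactly that Φ' = 0. Its constant value is read off as ρ → 0⁺, where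
  -- ρF' and N vanish.
  set Φ : ℝ → ℝ := fun ρ => 4 * (ρ * F' ρ) + (ρ - N ρ) * F ρ with hΦ
  have hd : ∀ ρ, 0 < ρ → HasDerivAt Φ 0 ρ := by
    intro ρ hρ
    have h1 := (((hasDerivAt_id ρ).mul (hF'' ρ hρ)).const_mul 4).add
      (((hasDerivAt_id ρ).sub (hN ρ)).mul (hF' ρ hρ))
    convert! h1 using 1
    simp only [id, Pi.sub_apply]
    linear_combination h ρ hρ
  have hl : Tendsto Φ (𝓝[>] 0) (𝓝 0) := by
    have h1 : Tendsto (fun ρ => (ρ - N ρ) * F ρ) (𝓝[>] 0) (𝓝 0) := by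
      have hNc : Continuous N := continuous_iff_continuousAt.2 fun v => (hN v).continuousAt
      have h2 : Continuous (fun ρ => (ρ - N ρ) * F ρ) := by fun_prop
      have h3 := h2.tendsto 0
      simp only [hN0, sub_zero, zero_mul] at h3
      exact h3.mono_left nhdsWithin_le_nhds
    simpa using (hlim.const_mul 4).add h1
  intro ρ hρ
  have hconst : Tendsto Φ (𝓝[>] 0) (𝓝 (Φ ρ)) := by
    refine tendsto_const_nhds.congr' ?_
    filter_upwards [self_mem_nhdsWithin] with s hs
    exact eq_of_hasDerivAt_zero_Ioi hd hρ hs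
  have := tendsto_nhds_unique hconst hl
  simp only [hΦ] at this
  linarith

/-! ### Radial functions sampled on a ray -/

/-- The unit vector spanning the ray on which radial functions are sampled. -/
noncomputable def rayDirection : Plane := EuclideanSpace.single 0 1

@[simp] theorem norm_rayDirection : ‖rayDirection‖ = 1 := by simp [rayDirection]

/-- A radial function as a function of `|x|²`. -/
noncomputable def radialPart (f : Plane → ℝ) (ρ : ℝ) : ℝ := f (√ρ • rayDirection)

theorem IsRadial.eq_radialPart {f : Plane → ℝ} (hf : IsRadial f) :
    f = fun x => radialPart f (‖x‖ ^ 2) := by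
  ext x
  refine hf _ _ ?_
  rw [Real.sqrt_sq (norm_nonneg x), norm_smul, norm_rayDirection, norm_norm, mul_one]

theorem continuous_radialPart {f : Plane → ℝ} (hf : Continuous f) : Continuous (radialPart f) := by
  unfold radialPart
  fun_prop

theorem hasDerivAt_radialPart {f : Plane → ℝ} {ρ : ℝ} (hρ : 0 < ρ)
    (hf : DifferentiableAt ℝ f (√ρ • rayDirection)) :
    HasDerivAt (radialPart f) (fderiv ℝ f (√ρ • rayDirection) rayDirection / (2 * √ρ)) ρ := by
  have h1 := (Real.hasDerivAt_sqrt hρ.ne').smul_const rayDirection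
  have h2 := hf.hasFDerivAt.comp_hasDerivAt ρ h1
  convert! h2 using 1
  rw [map_smul, smul_eq_mul]
  ring

theorem contDiffAt_radialPart {f : Plane → ℝ} {n : WithTop ℕ∞} (hf : ContDiff ℝ n f) {ρ : ℝ}
    (hρ : 0 < ρ) : ContDiffAt ℝ n (radialPart f) ρ :=
  hf.contDiffAt.comp ρ ((Real.contDiffAt_sqrt hρ.ne').smul contDiffAt_const)

/-- Passing to ρ through √ρ could make the derivative blow up like ρ^(-1/2); the factor ρ turns it
into √ρ ∂ᵣf / 2. This is the boundary condition that eliminates the constant in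
`flux_eq_of_selfSimilar`. -/
theorem tendsto_mul_deriv_radialPart {f : Plane → ℝ} (hf : ContDiff ℝ 1 f) :
    Tendsto (fun ρ => ρ * deriv (radialPart f) ρ) (𝓝[>] 0) (𝓝 0) := by
  have hc : Continuous (fun ρ : ℝ => √ρ * fderiv ℝ f (√ρ • rayDirection) rayDirection / 2) := by
    have := hf.continuous_fderiv one_ne_zero
    fun_prop
  have h0 := (hc.tendsto 0).mono_left (nhdsWithin_le_nhds (s := Ioi (0 : ℝ)))
  simp only [Real.sqrt_zero, zero_mul, zero_div] at h0
  refine h0.congr' ?_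
  filter_upwards [self_mem_nhdsWithin] with ρ hρ
  have hρ : 0 < ρ := hρ
  rw [(hasDerivAt_radialPart hρ (hf.differentiable one_ne_zero _)).deriv]
  have h1 : √ρ ≠ 0 := (Real.sqrt_pos.2 hρ).ne'
  field_simp
  rw [Real.sq_sqrt hρ.le, mul_comm]

/-! ### The explicit spreading solutions -/

/-- The unnormalized self-similar vortex as a function of `ρ = |x|²`. -/
noncomputable def spreadingShape (c b t ρ : ℝ) : ℝ := c * t⁻¹ * vortexShape b (ρ / (4 * t))

theorem contDiff_spreadingShape (c b t : ℝ) : ContDiff ℝ 2 (spreadingShape c b t) := by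
  have := contDiff_vortexShape b
  unfold spreadingShape
  fun_prop

theorem hasDerivAt_spreadingShape (c b t ρ : ℝ) :
    HasDerivAt (spreadingShape c b t)
      (c * t⁻¹ * (vortexShapeDeriv b (ρ / (4 * t)) * (1 / (4 * t)))) ρ :=
  ((hasDerivAt_vortexShape b (ρ / (4 * t))).comp ρ
    ((hasDerivAt_id ρ).div_const (4 * t))).const_mul (c * t⁻¹)

theorem hasDerivAt_deriv_spreadingShape (c b t ρ : ℝ) :
    HasDerivAt (fun ρ => c * t⁻¹ * (vortexShapeDeriv b (ρ / (4 * t)) * (1 / (4 * t))))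
      (c * t⁻¹ * (deriv (vortexShapeDeriv b) (ρ / (4 * t)) * (1 / (4 * t)) * (1 / (4 * t)))) ρ :=
  (((differentiable_vortexShapeDeriv b (ρ / (4 * t))).hasDerivAt.comp ρ
    ((hasDerivAt_id ρ).div_const (4 * t))).mul_const (1 / (4 * t))).const_mul (c * t⁻¹)

theorem hasDerivAt_spreadingShape_time (c b ρ : ℝ) {t : ℝ} (ht : 0 < t) :
    HasDerivAt (fun s => spreadingShape c b s ρ)
      (-(c * (t ^ 2)⁻¹ * (vortexShape b (ρ / (4 * t))
        + ρ / (4 * t) * vortexShapeDeriv b (ρ / (4 * t))))) t := by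
  have h1 : HasDerivAt (fun s : ℝ => ρ / (4 * s)) (-(ρ / (4 * t)) * t⁻¹) t := by
    have h2 := ((hasDerivAt_inv ht.ne').const_mul (ρ / 4))
    convert! h2 using 1
    · ext s; simp only [div_eq_mul_inv, mul_inv]; ring
    · field_simp
  have h3 := ((hasDerivAt_inv ht.ne').const_mul c).mul
    ((hasDerivAt_vortexShape b (ρ / (4 * t))).comp t h1)
  convert! h3 using 1
  simp only [Function.comp_apply]
  field_simp
  ring

theorem laplacian_spreadingShape (c b : ℝ) {t : ℝ} (ht : 0 < t) (x : Plane) :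
    Laplacian.laplacian (fun y : Plane => spreadingShape c b t (‖y‖ ^ 2)) x
      = c * (t ^ 2)⁻¹ * (vortexShapeDeriv b (‖x‖ ^ 2 / (4 * t))
        + ‖x‖ ^ 2 / (4 * t) * deriv (vortexShapeDeriv b) (‖x‖ ^ 2 / (4 * t))) := by
  rw [laplacian_comp_norm_sq (Eventually.of_forall (hasDerivAt_spreadingShape c b t))
    (hasDerivAt_deriv_spreadingShape c b t _)]
  field_simp
  ring

/-- This is the flux function N of the Gaussian divergence; its factor 4b is what makes b the
parameter of the vortex shape. -/
theorem integral_spreadingShape_zero (b : ℝ) {t : ℝ} (ht : 0 < t) (ρ : ℝ) :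
    ∫ s in (0 : ℝ)..ρ, spreadingShape b 0 t s = 4 * b * (1 - Real.exp (-(ρ / (4 * t)))) := by
  have h : ∀ s ∈ uIcc 0 ρ, HasDerivAt (fun s => 4 * b * (1 - Real.exp (-(s / (4 * t)))))
      (spreadingShape b 0 t s) s := by
    intro s _
    have h1 := (((hasDerivAt_id s).div_const (4 * t)).neg.exp.const_sub 1).const_mul (4 * b)
    convert! h1 using 1
    simp only [spreadingShape, vortexShape_zero_left, id, Pi.neg_apply]
    field_simp
  rw [intervalIntegral.integral_eq_sub_of_hasDerivAt h
    ((contDiff_spreadingShape b 0 t).continuous.intervalIntegrable _ _)]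
  simp

theorem integrable_spreadingShape (c b : ℝ) {t : ℝ} (ht : 0 < t) :
    Integrable (fun x : Plane => spreadingShape c b t (‖x‖ ^ 2)) :=
  (integrable_vortexShape b (by positivity)).const_mul _

theorem convolutionExists_spreadingShape (c b : ℝ) {t : ℝ} (ht : 0 < t) :
    ConvolutionExists (fun x : Plane => spreadingShape c b t (‖x‖ ^ 2)) kernelInvGrad
      (ContinuousLinearMap.lsmul ℝ ℝ) volume := by
  obtain ⟨C, hC⟩ := exists_abs_vortexShape_le b
  have hc := (contDiff_spreadingShape c b t).continuous
  refine convolutionExists_kernelInvGrad (C := |c * t⁻¹| * C) (by fun_prop) (fun x => ?_)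
    (integrable_spreadingShape c b ht)
  rw [spreadingShape, abs_mul]
  exact mul_le_mul_of_nonneg_left (hC _ (by positivity)) (abs_nonneg _)

theorem contDiff_comp_norm_sq {F : ℝ → ℝ} {n : WithTop ℕ∞} (hF : ContDiff ℝ n F) :
    ContDiff ℝ n (fun x : Plane => F (‖x‖ ^ 2)) :=
  hF.comp (contDiff_norm_sq ℝ)

/-- The spreading vortices solve the extended Navier–Stokes system. -/
theorem isRadialSelfSimilarSolution_spreadingShape {ω d : ℝ → Plane → ℝ} {c b : ℝ}
    (hω : ∀ t, 0 < t → ω t = fun x => spreadingShape c b t (‖x‖ ^ 2))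
    (hd : ∀ t, 0 < t → d t = fun x => spreadingShape b 0 t (‖x‖ ^ 2)) :
    IsRadialSelfSimilarSolution ω d := by
  have htime : ∀ {f : ℝ → Plane → ℝ} {c b : ℝ},
      (∀ t, 0 < t → f t = fun x => spreadingShape c b t (‖x‖ ^ 2)) → ∀ t, 0 < t → ∀ x,
      HasDerivAt (fun s => f s x) (-(c * (t ^ 2)⁻¹ * (vortexShape b (‖x‖ ^ 2 / (4 * t))
        + ‖x‖ ^ 2 / (4 * t) * vortexShapeDeriv b (‖x‖ ^ 2 / (4 * t))))) t := by
    intro f c b hf t ht x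
    refine (hasDerivAt_spreadingShape_time c b (‖x‖ ^ 2) ht).congr_of_eventuallyEq ?_
    filter_upwards [Ioi_mem_nhds ht] with s hs
    exact congrFun (hf s hs) x
  have hradial : ∀ {f : ℝ → Plane → ℝ} {c b : ℝ},
      (∀ t, 0 < t → f t = fun x => spreadingShape c b t (‖x‖ ^ 2)) →
      ∀ t, 0 < t → IsRadial (f t) := by
    intro f c b hf t ht x y hxy
    simp only [hf t ht, hxy]
  have hself : ∀ {f : ℝ → Plane → ℝ} {c b : ℝ},
      (∀ t, 0 < t → f t = fun x => spreadingShape c b t (‖x‖ ^ 2)) → IsSelfSimilar f := by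
    intro f c b hf l hl t ht x
    have h1 : (l * ‖x‖) ^ 2 / (4 * (l ^ 2 * t)) = ‖x‖ ^ 2 / (4 * t) := by field_simp
    rw [hf t ht, hf (l ^ 2 * t) (by positivity)]
    simp only [spreadingShape, norm_smul, Real.norm_of_nonneg hl.le, h1]
    field_simp
  have hcω : ∀ t, 0 < t → ConvolutionExists (ω t) kernelBS
      (ContinuousLinearMap.lsmul ℝ ℝ) volume := fun t ht x => by
    rw [hω t ht]
    exact convolutionExistsAt_kernelBS_iff.2 (convolutionExists_spreadingShape c b ht x)
  have hcd : ∀ t, 0 < t → ConvolutionExists (d t) kernelInvGrad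
      (ContinuousLinearMap.lsmul ℝ ℝ) volume := fun t ht => by
    rw [hd t ht]
    exact convolutionExists_spreadingShape b 0 ht
  have hav : ∀ c b t, Differentiable ℝ (segmentAverage (spreadingShape c b t)) := fun c b t =>
    (contDiff_segmentAverage ((contDiff_spreadingShape c b t).of_le
      (by norm_num))).differentiable one_ne_zero
  refine ⟨⟨?_, ?_, ?_, ?_, hcω, hcd, ?_, ?_, ?_⟩, hradial hω, hradial hd, hself hω, hself hd⟩
  · intro t ht
    rw [hω t ht]
    exact contDiff_comp_norm_sq (contDiff_spreadingShape c b t)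
  · intro t ht
    rw [hd t ht]
    exact contDiff_comp_norm_sq (contDiff_spreadingShape b 0 t)
  · exact fun t ht x => (htime hω t ht x).differentiableAt
  · exact fun t ht x => (htime hd t ht x).differentiableAt
  · intro t ht
    have h1 := hcω t ht
    have h2 := hcd t ht
    rw [hω t ht] at h1 ⊢
    rw [hd t ht] at h2 ⊢
    have h3 := funext fun x => velocity_radial (contDiff_spreadingShape c b t).continuous
      (contDiff_spreadingShape b 0 t).continuous (h1 x) (h2 x)
    have h4 : Differentiable ℝ perp := perpIsometry.toContinuousLinearEquiv.differentiable
    have h5 : ∀ F : ℝ → ℝ, Differentiable ℝ F →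
        Differentiable ℝ (fun x : Plane => F (‖x‖ ^ 2) / 2) := fun F hF => by
      simp only [div_eq_mul_inv]
      exact (hF.comp ((contDiff_norm_sq ℝ (E := Plane) (n := 1)).differentiable
        one_ne_zero)).mul_const _
    rw [show velocity _ _ = _ from h3]
    exact ((h5 _ (hav b 0 t)).smul differentiable_id).add ((h5 _ (hav c b t)).smul h4)
  · intro t ht x
    have h1 := hcω t ht
    have h2 := hcd t ht
    rw [(htime hω t ht x).deriv]
    rw [hω t ht] at h1 ⊢
    rw [hd t ht] at h2 ⊢
    -- After removal of the common factor c/t², the vorticity equation is the once-differentiated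
    -- profile equation in v = |x|²/(4t).
    rw [divergence_smul_velocity_radial (contDiff_spreadingShape c b t).continuous
      (contDiff_spreadingShape b 0 t).continuous h1 h2 (hasDerivAt_spreadingShape c b t _)
      (hav _ _ _ _) (hav _ _ _ _), laplacian_spreadingShape c b ht,
      integral_spreadingShape_zero b ht, vortexShapeDeriv_add_mul_deriv]
    simp only [spreadingShape, vortexShape_zero_left]
    generalize ‖x‖ ^ 2 / (4 * t) = v at *
    field_simp
    ring
  · intro t ht x
    rw [(htime hd t ht x).deriv, hd t ht, laplacian_spreadingShape b 0 ht,
      vortexShapeDeriv_add_mul_deriv]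
    ring

/-! ### Existence and uniqueness of the profile -/

/-- The normalized vortex profile. -/
noncomputable def vortexProfile (β : ℝ) (x : Plane) : ℝ :=
  (∫ y : Plane, vortexShape (β / (4 * Real.pi)) (‖y‖ ^ 2 / 4))⁻¹ *
    vortexShape (β / (4 * Real.pi)) (‖x‖ ^ 2 / 4)

theorem integral_vortexShape_pos (b : ℝ) :
    0 < ∫ y : Plane, vortexShape b (‖y‖ ^ 2 / 4) := by
  rw [integral_pos_iff_support_of_nonneg (fun x => (vortexShape_pos _ _).le)
    (integrable_vortexShape b (by norm_num))]
  have : Function.support (fun y : Plane => vortexShape b (‖y‖ ^ 2 / 4)) = univ := by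
    ext x; simp [(vortexShape_pos b (‖x‖ ^ 2 / 4)).ne']
  rw [this]
  simp

theorem isVortexProfile_vortexProfile (β : ℝ) : IsVortexProfile β (vortexProfile β) := by
  have hpi := Real.pi_pos
  set b := β / (4 * Real.pi) with hb
  set Z := ∫ y : Plane, vortexShape b (‖y‖ ^ 2 / 4) with hZ
  have hZ0 : 0 < Z := integral_vortexShape_pos b
  have hfd : ∀ x, HasFDerivAt (vortexProfile β)
      ((2 * (Z⁻¹ * (vortexShapeDeriv b (‖x‖ ^ 2 / 4) * (1 / 4)))) • innerSL ℝ x) x := by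
    intro x
    have h1 : HasDerivAt (fun ρ => Z⁻¹ * vortexShape b (ρ / 4))
        (Z⁻¹ * (vortexShapeDeriv b (‖x‖ ^ 2 / 4) * (1 / 4))) (‖x‖ ^ 2) :=
      ((hasDerivAt_vortexShape b (‖x‖ ^ 2 / 4)).comp (‖x‖ ^ 2)
        ((hasDerivAt_id (‖x‖ ^ 2)).div_const 4)).const_mul _
    exact hasFDerivAt_comp_norm_sq h1
  have hint : Integrable (fun x : Plane => vortexShape b (‖x‖ ^ 2 / 4)) :=
    integrable_vortexShape b (by norm_num)
  refine ⟨?_, ?_, fun x _ => (hfd x).differentiableAt, ?_, ?_, hint.const_mul _, ?_⟩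
  · exact continuous_iff_continuousAt.2 fun x => (hfd x).continuousAt
  · intro x y hxy
    simp only [vortexProfile, hxy]
  · intro x _
    exact (mul_pos (inv_pos.2 hZ0) (vortexShape_pos _ _)).ne'
  · intro x hx
    have hx0 : 0 < ‖x‖ := norm_pos_iff.2 hx
    have hin : innerSL ℝ x (‖x‖⁻¹ • x) = ‖x‖ := by
      rw [map_smul, innerSL_apply_apply, real_inner_self_eq_norm_sq, smul_eq_mul]
      field_simp
    have hH := vortexShape_pos b (‖x‖ ^ 2 / 4)
    have hHd : vortexShapeDeriv b (‖x‖ ^ 2 / 4) = vortexShape b (‖x‖ ^ 2 / 4) *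
        (-(‖x‖ ^ 2 / 4) + b * (1 - Real.exp (-(‖x‖ ^ 2 / 4)))) / (‖x‖ ^ 2 / 4) := by
      rw [eq_div_iff (by positivity), mul_comm]
      exact mul_vortexShapeDeriv b _
    rw [radialDeriv, (hfd x).fderiv, smul_apply, hin, smul_eq_mul,
      vortexProfile, ← hb, ← hZ, hHd, neg_div (4 : ℝ)]
    have hβ : β = 4 * Real.pi * b := by rw [hb]; field_simp
    rw [hβ]
    clear_value b Z
    clear hb hβ hZ hHd hfd hint hin
    field_simp
    ring
  · simp only [vortexProfile]
    rw [integral_const_mul, inv_mul_cancel₀ hZ0.ne']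

/-- Since ∂ᵣ = 2r ∂_ρ, multiplying the profile equation by 2r gives 4ρF' = (4b(1 - exp(-ρ/4)) - ρ)F
with b = β/(4π). Its solutions form a line, and unit mass selects one point on it. -/
theorem IsVortexProfile.eq_vortexProfile {β : ℝ} {W : Plane → ℝ} (hW : IsVortexProfile β W) :
    W = vortexProfile β := by
  have hpi := Real.pi_pos
  have hder : ∀ ρ, 0 < ρ → HasDerivAt (radialPart W)
      (radialDeriv W (√ρ • rayDirection) / (2 * √ρ)) ρ := by
    intro ρ hρ
    have h0 : 0 < √ρ := Real.sqrt_pos.2 hρ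
    have hne : √ρ • rayDirection ≠ 0 := by
      rw [← norm_ne_zero_iff, norm_smul, norm_rayDirection, mul_one, norm_ne_zero_iff]
      exact h0.ne'
    convert! hasDerivAt_radialPart hρ (hW.differentiableAt _ hne) using 2
    rw [radialDeriv, norm_smul, norm_rayDirection, mul_one, Real.norm_of_nonneg h0.le, smul_smul,
      inv_mul_cancel₀ h0.ne', one_smul]
  obtain ⟨c, hc⟩ := exists_eq_mul_vortexShape (b := β / (4 * Real.pi))
    (continuous_radialPart hW.continuous) hder (by
      intro ρ hρ
      have h0 : 0 < √ρ := Real.sqrt_pos.2 hρ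
      have hn : ‖√ρ • rayDirection‖ = √ρ := by
        rw [norm_smul, norm_rayDirection, mul_one, Real.norm_of_nonneg h0.le]
      have hne : √ρ • rayDirection ≠ 0 := by
        rw [← norm_ne_zero_iff, hn]; exact h0.ne'
      have h1 := hW.ode _ hne
      rw [div_eq_iff (hW.ne_zero _ hne), hn, Real.sq_sqrt hρ.le] at h1
      rw [h1, neg_div (4 : ℝ), radialPart]
      generalize W (√ρ • rayDirection) = w
      have h2 : √ρ ^ 2 = ρ := Real.sq_sqrt hρ.le
      generalize Real.exp (-(ρ / 4)) = e
      rw [← h2, Real.sqrt_sq h0.le]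
      field_simp
      ring)
  have hWeq : W = fun x => c * vortexShape (β / (4 * Real.pi)) (‖x‖ ^ 2 / 4) := by
    rw [hW.radial.eq_radialPart]
    ext x
    exact hc _ (by positivity)
  have hm := hW.mass
  rw [hWeq, integral_const_mul] at hm
  rw [hWeq]
  ext x
  rw [vortexProfile, eq_inv_of_mul_eq_one_left hm]

/-! ### Rescaling and conservation of mass -/

theorem norm_inv_sqrt_smul_sq {t : ℝ} (ht : 0 < t) (x : Plane) :
    ‖(√t)⁻¹ • x‖ ^ 2 = ‖x‖ ^ 2 / t := by
  rw [norm_smul, mul_pow, norm_inv, inv_pow, Real.norm_of_nonneg (Real.sqrt_nonneg t),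
    Real.sq_sqrt ht.le]
  ring

theorem mul_rescale_vortexProfile (α β : ℝ) {t : ℝ} (ht : 0 < t) (x : Plane) :
    α * rescale (vortexProfile β) t x = spreadingShape
      (α * (∫ y : Plane, vortexShape (β / (4 * Real.pi)) (‖y‖ ^ 2 / 4))⁻¹)
      (β / (4 * Real.pi)) t (‖x‖ ^ 2) := by
  rw [rescale, vortexProfile, norm_inv_sqrt_smul_sq ht, spreadingShape, div_div, mul_comm t 4]
  ring

theorem mul_rescale_gaussian (β : ℝ) {t : ℝ} (ht : 0 < t) (x : Plane) :
    β * rescale gaussian t x = spreadingShape (β / (4 * Real.pi)) 0 t (‖x‖ ^ 2) := by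
  rw [rescale, gaussian, norm_inv_sqrt_smul_sq ht, spreadingShape, vortexShape_zero_left, neg_div,
    div_div, mul_comm t 4]
  ring

theorem integrable_rescale {F : Plane → ℝ} (hF : Integrable F) {t : ℝ} (ht : 0 < t) :
    Integrable (rescale F t) :=
  (hF.comp_smul (inv_ne_zero (Real.sqrt_pos.2 ht).ne')).const_mul _

theorem integral_rescale (F : Plane → ℝ) {t : ℝ} (ht : 0 < t) :
    ∫ x, rescale F t x = ∫ x, F x := by
  simp only [rescale]
  rw [integral_const_mul, Measure.integral_comp_smul]
  -- In dimension 2 the Jacobian is t, which cancels the prefactor t⁻¹.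
  have : |((√t)⁻¹ ^ Module.finrank ℝ Plane)⁻¹| = t := by
    rw [finrank_euclideanSpace_fin, inv_pow, inv_inv, Real.sq_sqrt ht.le, abs_of_pos ht]
  rw [this, smul_eq_mul, inv_mul_cancel_left₀ ht.ne']

theorem gaussian_eq (x : Plane) :
    gaussian x = (4 * Real.pi)⁻¹ * Real.exp (-(1 / 4) * ‖x‖ ^ 2) := by
  rw [gaussian]; congr 2; ring

theorem integrable_gaussian_plane : Integrable gaussian := by
  rw [funext gaussian_eq]
  exact (integrable_exp_neg_mul_norm_sq (by norm_num)).const_mul _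

theorem integral_gaussian_plane : ∫ x, gaussian x = 1 := by
  simp only [gaussian_eq]
  rw [integral_const_mul, integral_exp_neg_mul_norm_sq (by norm_num)]
  have := Real.pi_pos
  field_simp

/-- Scaling by l = 1/√t carries time t to time 1, so a self-similar function is determined by its
slice at time one. -/
theorem IsSelfSimilar.eq_rescale {f : ℝ → Plane → ℝ} (hf : IsSelfSimilar f) {t : ℝ} (ht : 0 < t) :
    f t = rescale (f 1) t := by
  ext x
  have h := hf (√t)⁻¹ (inv_pos.2 (Real.sqrt_pos.2 ht)) t ht x
  rw [inv_pow, Real.sq_sqrt ht.le, inv_mul_cancel₀ ht.ne'] at h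
  exact h.symm

/-! ### Classification at time one -/

/-- The time derivative of a radial self-similar function at time one. -/
theorem IsSelfSimilar.deriv_one {f : ℝ → Plane → ℝ} (hf : IsSelfSimilar f) {F : ℝ → ℝ}
    (hF : f 1 = fun x => F (‖x‖ ^ 2)) {x : Plane} {F' : ℝ} (hF' : HasDerivAt F F' (‖x‖ ^ 2)) :
    deriv (fun s => f s x) 1 = -(F (‖x‖ ^ 2) + ‖x‖ ^ 2 * F') := by
  have h1 : (fun s => f s x) =ᶠ[𝓝 1] fun s => s⁻¹ * F (‖x‖ ^ 2 * s⁻¹) := by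
    filter_upwards [Ioi_mem_nhds one_pos] with s hs
    rw [hf.eq_rescale hs, rescale, hF]
    simp only [norm_inv_sqrt_smul_sq hs, div_eq_mul_inv]
  have h2 := (hasDerivAt_inv (one_ne_zero (α := ℝ))).const_mul (‖x‖ ^ 2)
  have h3 : HasDerivAt F F' (‖x‖ ^ 2 * (1 : ℝ)⁻¹) := by simpa using hF'
  have h4 := (hasDerivAt_inv (one_ne_zero (α := ℝ))).mul (h3.comp 1 h2)
  have h5 : deriv (fun s : ℝ => s⁻¹ * F (‖x‖ ^ 2 * s⁻¹)) 1 = _ := h4.deriv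
  rw [h1.deriv_eq, h5]
  simp
  ring

/-- The classification of radial self-similar solutions. -/
theorem IsRadialSelfSimilarSolution.exists_eq {ω d : ℝ → Plane → ℝ}
    (h : IsRadialSelfSimilarSolution ω d) :
    ∃ c b : ℝ, (ω 1 = fun x => spreadingShape c b 1 (‖x‖ ^ 2)) ∧
      (d 1 = fun x => spreadingShape b 0 1 (‖x‖ ^ 2)) := by
  have hs := h.solution
  have hωC := hs.contDiff_vorticity 1 one_pos
  have hdC := hs.contDiff_div 1 one_pos
  set F := radialPart (ω 1) with hF
  set D := radialPart (d 1) with hD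
  have hωF : ω 1 = fun x => F (‖x‖ ^ 2) := (h.radial_vorticity 1 one_pos).eq_radialPart
  have hdD : d 1 = fun x => D (‖x‖ ^ 2) := (h.radial_div 1 one_pos).eq_radialPart
  have hFc : Continuous F := continuous_radialPart hωC.continuous
  have hDc : Continuous D := continuous_radialPart hdC.continuous
  have hderiv : ∀ {f : Plane → ℝ}, ContDiff ℝ 2 f → ∀ ρ, 0 < ρ →
      HasDerivAt (radialPart f) (deriv (radialPart f) ρ) ρ := fun hf ρ hρ =>
    ((contDiffAt_radialPart hf hρ).differentiableAt two_ne_zero).hasDerivAt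
  have hderiv2 : ∀ {f : Plane → ℝ}, ContDiff ℝ 2 f → ∀ ρ, 0 < ρ →
      HasDerivAt (deriv (radialPart f)) (deriv (deriv (radialPart f)) ρ) ρ := by
    intro f hf ρ hρ
    have h1 : ContDiffAt ℝ 1 (deriv (radialPart f)) ρ :=
      ((contDiffAt_radialPart hf hρ).fderiv_right (m := 1) (by norm_num)).clm_apply
        contDiffAt_const
    exact (h1.differentiableAt one_ne_zero).hasDerivAt
  have hlap : ∀ {f : Plane → ℝ}, ContDiff ℝ 2 f → ∀ x : Plane, x ≠ 0 →
      Laplacian.laplacian (fun y : Plane => radialPart f (‖y‖ ^ 2)) x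
        = 4 * ‖x‖ ^ 2 * deriv (deriv (radialPart f)) (‖x‖ ^ 2)
          + 4 * deriv (radialPart f) (‖x‖ ^ 2) := by
    intro f hf x hx
    have hx0 : 0 < ‖x‖ ^ 2 := by have := norm_pos_iff.2 hx; positivity
    refine laplacian_comp_norm_sq ?_ (hderiv2 hf _ hx0)
    filter_upwards [Ioi_mem_nhds hx0] with s hs'
    exact hderiv hf s hs'
  have hpoint : ∀ ρ : ℝ, 0 < ρ → ∃ x : Plane, x ≠ 0 ∧ ‖x‖ ^ 2 = ρ := by
    intro ρ hρ
    have hn : ‖√ρ • rayDirection‖ ^ 2 = ρ := by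
      rw [norm_smul, norm_rayDirection, mul_one, Real.norm_of_nonneg (Real.sqrt_nonneg ρ),
        Real.sq_sqrt hρ.le]
    refine ⟨√ρ • rayDirection, ?_, hn⟩
    intro h0
    rw [h0] at hn
    simp at hn
    exact hρ.ne hn
  have hF1 : ∀ ρ, 0 < ρ → HasDerivAt F (deriv F ρ) ρ := hderiv hωC
  have hD1 : ∀ ρ, 0 < ρ → HasDerivAt D (deriv D ρ) ρ := hderiv hdC
  have hF2 : ∀ ρ, 0 < ρ → HasDerivAt (deriv F) (deriv (deriv F) ρ) ρ := hderiv2 hωC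
  have hD2 : ∀ ρ, 0 < ρ → HasDerivAt (deriv D) (deriv (deriv D) ρ) ρ := hderiv2 hdC
  have hFl := tendsto_mul_deriv_radialPart (hωC.of_le (by norm_num))
  have hDl := tendsto_mul_deriv_radialPart (hdC.of_le (by norm_num))
  have hFlap : ∀ x : Plane, x ≠ 0 → Laplacian.laplacian (fun y : Plane => F (‖y‖ ^ 2)) x
      = 4 * ‖x‖ ^ 2 * deriv (deriv F) (‖x‖ ^ 2) + 4 * deriv F (‖x‖ ^ 2) := hlap hωC
  have hDlap : ∀ x : Plane, x ≠ 0 → Laplacian.laplacian (fun y : Plane => D (‖y‖ ^ 2)) x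
      = 4 * ‖x‖ ^ 2 * deriv (deriv D) (‖x‖ ^ 2) + 4 * deriv D (‖x‖ ^ 2) := hlap hdC
  rw [← hF] at hFl
  rw [← hD] at hDl
  clear_value F D
  clear hF hD
  -- The heat equation for d is the case of zero flux; the profile equation with parameter 0 then
  -- leaves only Gaussians.
  have hDode := flux_eq_of_selfSimilar (N := fun _ => 0) (D := fun _ => 0) hDc hD1
    hD2 (fun ρ => hasDerivAt_const ρ 0) rfl
    hDl (by
      intro ρ hρ
      obtain ⟨x, hx, rfl⟩ := hpoint ρ hρ
      have h1 := hs.div_eq 1 one_pos x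
      rw [h.selfSimilar_div.deriv_one hdD (hD1 _ hρ), hdD, hDlap x hx] at h1
      linear_combination h1)
  -- The amplitude b found here becomes the parameter of the vorticity equation, through N = 4b(1 -
  -- exp(-ρ/4)).
  obtain ⟨b, hb⟩ := exists_eq_mul_vortexShape (b := 0) hDc hD1 (by
    intro ρ hρ
    rw [hDode ρ hρ]; ring)
  have hd1 : d 1 = fun x => spreadingShape b 0 1 (‖x‖ ^ 2) := by
    rw [hdD]
    ext x
    rw [hb _ (by positivity)]
    simp [spreadingShape]
  have hN : ∀ ρ, HasDerivAt (fun ρ => ∫ s in (0 : ℝ)..ρ, spreadingShape b 0 1 s)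
      (spreadingShape b 0 1 ρ) ρ := fun ρ =>
    ((contDiff_spreadingShape b 0 1).continuous.integral_hasStrictDerivAt 0 ρ).hasDerivAt
  have hFode := flux_eq_of_selfSimilar hFc hF1 hF2 hN (by simp)
    hFl (by
      intro ρ hρ
      obtain ⟨x, hx, rfl⟩ := hpoint ρ hρ
      have h1 := hs.vorticity_eq 1 one_pos x
      have hc1 := hs.convolutionExists_vorticity 1 one_pos
      have hc2 := hs.convolutionExists_div 1 one_pos
      rw [h.selfSimilar_vorticity.deriv_one hωF (hF1 _ hρ)] at h1
      rw [hd1] at h1 hc2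
      rw [hωF] at h1 hc1
      rw [divergence_smul_velocity_radial hFc (contDiff_spreadingShape b 0 1).continuous hc1 hc2
        (hF1 _ hρ) (differentiableAt_segmentAverage_of_ne hFc hρ.ne')
        (differentiableAt_segmentAverage_of_ne (contDiff_spreadingShape b 0 1).continuous hρ.ne'),
        hFlap x hx] at h1
      exact h1)
  obtain ⟨c, hc⟩ := exists_eq_mul_vortexShape (b := b) hFc hF1 (by
    intro ρ hρ
    rw [hFode ρ hρ, integral_spreadingShape_zero b one_pos, mul_one])
  refine ⟨c, b, ?_, hd1⟩
  rw [hωF]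
  ext x
  rw [hc _ (by positivity)]
  simp [spreadingShape]

end ExtendedNS

/-! ### Main theorem -/

open ExtendedNS in
theorem mainTheorem4 :
    (∀ β : ℝ, ∃! W : ExtendedNS.Plane → ℝ, ExtendedNS.IsVortexProfile β W) ∧
    (∀ (α β : ℝ) (W : ExtendedNS.Plane → ℝ), ExtendedNS.IsVortexProfile β W →
      ExtendedNS.IsRadialSelfSimilarSolution
        (fun t x => α * ExtendedNS.rescale W t x)
        (fun t x => β * ExtendedNS.rescale ExtendedNS.gaussian t x)) ∧
    (∀ ω d : ℝ → ExtendedNS.Plane → ℝ, ExtendedNS.IsRadialSelfSimilarSolution ω d →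
      ∃ (α β : ℝ) (W : ExtendedNS.Plane → ℝ), ExtendedNS.IsVortexProfile β W ∧
        ∀ t : ℝ, 0 < t →
          (∀ x, ω t x = α * ExtendedNS.rescale W t x) ∧
          (∀ x, d t x = β * ExtendedNS.rescale ExtendedNS.gaussian t x) ∧
          MeasureTheory.Integrable (ω t) ∧ ∫ x, ω t x = α ∧
          MeasureTheory.Integrable (d t) ∧ ∫ x, d t x = β) := by
  refine ⟨fun β => ⟨vortexProfile β, isVortexProfile_vortexProfile β,
    fun W hW => hW.eq_vortexProfile⟩, ?_, ?_⟩
  · rintro α β W hW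
    rw [hW.eq_vortexProfile]
    exact isRadialSelfSimilarSolution_spreadingShape
      (fun t ht => funext fun x => mul_rescale_vortexProfile α β ht x)
      (fun t ht => funext fun x => mul_rescale_gaussian β ht x)
  · intro ω d h
    obtain ⟨c, b, hω, hd⟩ := h.exists_eq
    have hpi := Real.pi_pos
    -- The function b exp(-|x|²/4) has mass 4πb, so β = 4πb; likewise α = cZ, where Z is the mass of
    -- the unnormalized shape.
    have hb : 4 * Real.pi * b / (4 * Real.pi) = b := by field_simp
    have hZ := (integral_vortexShape_pos b).ne'
    set Z := ∫ y : Plane, vortexShape b (‖y‖ ^ 2 / 4) with hZdef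
    have hprof := isVortexProfile_vortexProfile (4 * Real.pi * b)
    have hω1 : ω 1 = fun x => c * Z * vortexProfile (4 * Real.pi * b) x := by
      rw [hω]
      ext x
      rw [vortexProfile, hb, ← hZdef, spreadingShape]
      field_simp
    have hd1 : d 1 = fun x => 4 * Real.pi * b * gaussian x := by
      rw [hd]
      ext x
      rw [gaussian, spreadingShape, vortexShape_zero_left, neg_div, mul_one]
      field_simp
    have hωt : ∀ t, 0 < t → ω t = fun x =>
        c * Z * rescale (vortexProfile (4 * Real.pi * b)) t x := by
      intro t ht
      rw [h.selfSimilar_vorticity.eq_rescale ht, hω1]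
      ext x
      simp only [rescale]
      ring
    have hdt : ∀ t, 0 < t → d t = fun x => 4 * Real.pi * b * rescale gaussian t x := by
      intro t ht
      rw [h.selfSimilar_div.eq_rescale ht, hd1]
      ext x
      simp only [rescale]
      ring
    refine ⟨c * Z, 4 * Real.pi * b, vortexProfile (4 * Real.pi * b), hprof, fun t ht =>
      ⟨congrFun (hωt t ht), congrFun (hdt t ht), ?_, ?_, ?_, ?_⟩⟩
    · rw [hωt t ht]
      exact (integrable_rescale hprof.integrable ht).const_mul _
    · rw [hωt t ht, integral_const_mul, integral_rescale _ ht, hprof.mass, mul_one]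
    · rw [hdt t ht]
      exact (integrable_rescale integrable_gaussian_plane ht).const_mul _
    · rw [hdt t ht, integral_const_mul, integral_rescale _ ht, integral_gaussian_plane, mul_one]
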